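/- **Construction schemes.** A *type* is a sequence $\tau=\langle m_k,n_{k+1},r_{k+1}\rangle_{k\in\omega}$ of triples of natural numbers with $m_0=1$, $n_{k+1}\ge 2$, $r_{k+1}<m_k$ and $m_{k+1}=r_{k+1}+(m_k-r_{k+1})n_{k+1}$ for all $k$. It is *good* if every $r\in\omega$ equals $r_k$ for infinitely many $k\geq 1$. Let $\mathrm{Fin}(\omega_1)$ be the set of nonempty finite subsets of $\omega_1$; for finite $A,B\subseteq\omega_1$ write $A<B$ if every element of $A$ is smaller than every element of $B$. A *construction scheme* of type $\tau$ is a family $\mathcal F\subseteq\mathrm{Fin}(\omega_1)$ that is cofinal in $(\mathrm{Fin}(\omega_1),\subseteq)$, all of whose members have cardinality $m_k$ for some $k$, and such that, with $\mathcal F_k=\{F\in\mathcal F:|F|=m_k\}$, for every $k$: (i) $E\cap F$ is an initial segment of both $E$ and $F$ for all $E,F\in\mathcal F_k$; (ii) every $F\in\mathcal F_{k+1}$ is a union $\bigcup_{i<n_{k+1}}F_i$ of members of $\mathcal F_k$ forming a $\Delta$-system with a root $R(F)$ such that $|R(F)|=r_{k+1}$ and $R(F)<F_0\setminus R(F)<\dots<F_{n_{k+1}-1}\setminus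 R(F)$. It is a *$2$-construction scheme* if its type is good and $n_k=2$ for all $k\ge1$. For $\alpha,\beta\in\omega_1$ let $\rho(\alpha,\beta)=\min\{k:\exists F\in\mathcal F_k\ \{\alpha,\beta\}\subseteq F\}$, $\|\alpha\|_k=|\{\xi<\alpha:\rho(\alpha,\xi)\le k\}|$, and $\Delta(\alpha,\beta)=\min\{k:\|\alpha\|_k\ne\|\beta\|_k\}$ (which is $\omega$ if there is no such $k$). Let $\Xi_\alpha(0)=0$ and, for $k\ge1$ and any $F\in\mathcal F_k$ with $\alpha\in F$, let $\Xi_\alpha(k)=-1$ if $\alpha\in R(F)$ and $\Xi_\alpha(k)=i$ if $\alpha\in F_i\setminus R(F)$. **Capturing.** Let $\langle D_i\rangle_{i<n}$ be distinct finite subsets of $\omega_1$, all of the same size $m\ge1$, forming a $\Delta$-system with a root $R$ such that $R<D_i\setminus R$ for all $i$ and the sets $D_i\setminus R$ are pairwise comparable under $<$. Write $D_i(a)$ for the $a$-th element of $D_i$ ($a<m$). The sequence is *captured at level $l$* if for all $i<n$ and $a<m$ we have $\Xi_{D_i(a)}(l)=-1$ when $a<|R|$ and $\Xi_{D_i(a)}(l)=i$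 when $a\ge|R|$, and $\rho(D_i(a),D_j(a))=l=\Delta(D_i(a),D_j(a))$ for all $i<j<n$ and $|R|\le a<m$. The scheme $\mathcal F$ is *$n$-capturing* if for every uncountable $S\subseteq\mathrm{Fin}(\omega_1)$ there are infinitely many $l$ for which some $n$ distinct members of $S$, suitably enumerated, are captured at level $l$. **Martin numbers.** For a forcing notion $\mathbb P$ let $\mathfrak m(\mathbb P)$ be the least cardinality of a family of dense subsets of $\mathbb P$ that are not all met by a single filter on $\mathbb P$ ($\infty$ if there is no such family). If $\mathcal F$ is $2$-capturing, let $\mathfrak m_{\mathcal F}$ be the minimum of $\mathfrak m(\mathbb P)$ over all ccc forcing notions $\mathbb P$ that force "$\mathcal F$ is $2$-capturing"; otherwise let $\mathfrak m_{\mathcal F}=\omega$. **Gaps.** A pair $(\mathcal L,\mathcal R)$ of families of subsets of $\omega$ is a *gap* if $L\cap R$ is finite for all $L\in\mathcal L$, $R\in\mathcal R$, and there is no $C\subseteq\omega$ such that $L\setminus C$ and $C\cap R$ are finite for all $L\in\mathcal L$, $R\in\mathcal R$. An *$(\omega_1,\omega_1)$-gap* is a gap whose two sides are enumerated as $(L_\alpha,R_\alpha)_{\alpha\in\omega_1}$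 so that $L_\alpha\setminus L_\beta$ and $R_\alpha\setminus R_\beta$ are finite for all $\alpha\le\beta$. It is *Hausdorff* if $\{\alpha<\beta:L_\beta\cap R_\alpha\subseteq k\}$ is finite for all $\beta\in\omega_1$ and $k\in\omega$. It is *levelwise-inseparable* if $(L_{\alpha+1}\setminus L_\alpha,\,R_{\alpha+1}\setminus R_\alpha)_{\alpha\in\omega_1}$ is a gap, and *weakly levelwise-inseparable* if there is a levelwise-inseparable $(\omega_1,\omega_1)$-gap $(L'_\alpha,R'_\alpha)_{\alpha\in\omega_1}$ with $\{L'_\alpha\}_\alpha\subseteq\{L_\alpha\}_\alpha$ and $\{R'_\alpha\}_\alpha\subseteq\{R_\alpha\}_\alpha$ (a levelwise-inseparable subgap). **Theorem.** Let $\mathcal F$ be a $2$-capturing $2$-construction scheme with $\mathfrak m_{\mathcal F}>\omega_1$. For $\alpha\in\omega_1$ put $$L_\alpha=\{2k+\Xi_\alpha(k):k\ge1,\ \Xi_\alpha(k)\ge0\},\qquad R_\alpha=\{2k+(1-\Xi_\alpha(k)):k\ge1,\ \Xi_\alpha(k)\ge0\}.$$ Then $(L_\alpha,R_\alpha)_{\alpha\in\omega_1}$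 is a Hausdorff $(\omega_1,\omega_1)$-gap that is not weakly levelwise-inseparable, i.e. it has no levelwise-inseparable subgap. -/

import Mathlib

noncomputable section

/-- The first uncountable ordinal, as a well-ordered type. -/
abbrev Omega1 : Type := (Ordinal.omega 1 : Ordinal.{0}).ToType

/-- `Fin(ω₁)`: the nonempty finite subsets of `ω₁`. -/
abbrev FinOmega1 : Type := {s : Finset Omega1 // s.Nonempty}

/-! ### Construction schemes -/

/-- A type `⟨m_k, n_{k+1}, r_{k+1}⟩_{k ∈ ω}`. The values `n 0` and `r 0` are not used. -/
structure SchemeType where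
  m : ℕ → ℕ
  n : ℕ → ℕ
  r : ℕ → ℕ
  m_zero : m 0 = 1
  two_le_n : ∀ k, 2 ≤ n (k + 1)
  r_lt_m : ∀ k, r (k + 1) < m k
  m_succ : ∀ k, m (k + 1) = r (k + 1) + (m k - r (k + 1)) * n (k + 1)

/-- Every natural number occurs infinitely often as some `r_k`, `k ≥ 1`. -/
def SchemeType.Good (τ : SchemeType) : Prop :=
  ∀ a : ℕ, {k : ℕ | τ.r (k + 1) = a}.Infinite

/-- `A < B`: every element of `A` is below every element of `B`. -/
def Finset.Before (A B : Finset Omega1) : Prop :=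
  ∀ a ∈ A, ∀ b ∈ B, a < b

/-- `A ⊑ B`: `A` is an initial segment of `B`. -/
def Finset.IsInitialSegment (A B : Finset Omega1) : Prop :=
  A ⊆ B ∧ ∀ a ∈ A, ∀ b ∈ B, b ≤ a → b ∈ A

/-- `𝓕_k`, the members of `𝓕` with `m_k` elements. -/
def schemeLevel (τ : SchemeType) (𝓕 : Set (Finset Omega1)) (k : ℕ) : Set (Finset Omega1) :=
  {E ∈ 𝓕 | E.card = τ.m k}

/-- `⟨D_i⟩_{i < n_{k+1}}` is a decomposition of `E` into members of `𝓕_k` that form a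
`Δ`-system with root `R`, where `|R| = r_{k+1}` and `R < D_0 \ R < D_1 \ R < ⋯`. -/
structure IsCanonicalDecomposition (τ : SchemeType) (𝓕 : Set (Finset Omega1)) (k : ℕ)
    (E : Finset Omega1) (D : Fin (τ.n (k + 1)) → Finset Omega1) (R : Finset Omega1) : Prop where
  mem_level : ∀ i, D i ∈ schemeLevel τ 𝓕 k
  eq_union : E = Finset.univ.biUnion D
  inter_eq : ∀ i j, i ≠ j → D i ∩ D j = R
  card_root : R.card = τ.r (k + 1)
  root_before : ∀ i, R.Before (D i \ R)
  tails : ∀ i j, i < j → (D i \ R).Before (D j \ R)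

/-- `𝓕` is a construction scheme of type `τ` over `ω₁`. -/
structure IsConstructionScheme (τ : SchemeType) (𝓕 : Set (Finset Omega1)) : Prop where
  nonempty_of_mem : ∀ E ∈ 𝓕, E.Nonempty
  cofinal : ∀ A : Finset Omega1, A.Nonempty → ∃ E ∈ 𝓕, A ⊆ E
  card_mem : ∀ E ∈ 𝓕, ∃ k, E.card = τ.m k
  inter_initial : ∀ k, ∀ E ∈ schemeLevel τ 𝓕 k, ∀ E' ∈ schemeLevel τ 𝓕 k,
    (E ∩ E').IsInitialSegment E ∧ (E ∩ E').IsInitialSegment E'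
  decomposition : ∀ k, ∀ E ∈ schemeLevel τ 𝓕 (k + 1),
    ∃ D R, IsCanonicalDecomposition τ 𝓕 k E D R

/-- `ρ(α, β)`, the least `k` such that some member of `𝓕_k` contains `α` and `β`. -/
def schemeRho (τ : SchemeType) (𝓕 : Set (Finset Omega1)) (α β : Omega1) : ℕ :=
  sInf {k : ℕ | ∃ E ∈ schemeLevel τ 𝓕 k, α ∈ E ∧ β ∈ E}

/-- `‖α‖_k`, the number of `ξ < α` with `ρ(α, ξ) ≤ k`. -/
def schemeNorm (τ : SchemeType) (𝓕 : Set (Finset Omega1)) (α : Omega1) (k : ℕ) : ℕ :=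
  {ξ : Omega1 | ξ < α ∧ schemeRho τ 𝓕 α ξ ≤ k}.ncard

/-- `Δ(α, β)`, the least `k` with `‖α‖_k ≠ ‖β‖_k`, and `ω` if there is none. -/
def schemeDelta (τ : SchemeType) (𝓕 : Set (Finset Omega1)) (α β : Omega1) : ℕ∞ :=
  sInf {x : ℕ∞ | ∃ k : ℕ, schemeNorm τ 𝓕 α k ≠ schemeNorm τ 𝓕 β k ∧ x = (k : ℕ∞)}

open Classical in
/-- `Ξ_α(k)`. For `k ≥ 1` it is the `i` such that `α ∈ E_i \ R(E)` for an `E ∈ 𝓕_k` with canonical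
decomposition `⟨E_i⟩` and root `R(E)`, and it is `-1` if there is none, that is, if `α` lies in the
root of the members of `𝓕_k` that contain it. (For a construction scheme, neither depends on the
choice of `E`.) -/
def schemeXi (τ : SchemeType) (𝓕 : Set (Finset Omega1)) (α : Omega1) : ℕ → ℤ
  | 0 => 0
  | k + 1 =>
    if h : ∃ i : Fin (τ.n (k + 1)), ∃ E ∈ schemeLevel τ 𝓕 (k + 1), ∃ D R,
        IsCanonicalDecomposition τ 𝓕 k E D R ∧ α ∈ D i \ R
    then ((h.choose : ℕ) : ℤ)
    else -1

/-- `⟨D_i⟩_{i < n}` is a root-tail-tail `Δ`-system with root `R`. -/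
structure IsRootTailTail {n : ℕ} (D : Fin n → Finset Omega1) (R : Finset Omega1) : Prop where
  root_subset : ∀ i, R ⊆ D i
  inter_eq : ∀ i j, i ≠ j → D i ∩ D j = R
  root_before : ∀ i, R.Before (D i \ R)
  tails : ∀ i j, i ≠ j → (D i \ R).Before (D j \ R) ∨ (D j \ R).Before (D i \ R)

/-- `⟨D_i⟩_{i < n}` is captured at level `l`; here `(D i).orderEmbOfFin _ a` is `D_i(a)`, the
element of `D_i` with index `a` in the increasing enumeration. -/
def IsCapturedAt (τ : SchemeType) (𝓕 : Set (Finset Omega1)) {n : ℕ}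
    (D : Fin n → Finset Omega1) (l : ℕ) : Prop :=
  ∃ (m : ℕ) (hm : ∀ i, (D i).card = m) (R : Finset Omega1),
    1 ≤ m ∧ IsRootTailTail D R ∧
    (∀ (i : Fin n) (a : Fin m), schemeXi τ 𝓕 ((D i).orderEmbOfFin (hm i) a) l =
      if (a : ℕ) < R.card then -1 else ((i : ℕ) : ℤ)) ∧
    (∀ (i j : Fin n) (a : Fin m), i < j → R.card ≤ (a : ℕ) →
      schemeRho τ 𝓕 ((D i).orderEmbOfFin (hm i) a) ((D j).orderEmbOfFin (hm j) a) = l ∧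
      schemeDelta τ 𝓕 ((D i).orderEmbOfFin (hm i) a) ((D j).orderEmbOfFin (hm j) a) = (l : ℕ∞))

/-- `𝓕` is `n`-capturing: for every uncountable `S ⊆ Fin(ω₁)` there are infinitely many `l` for
which some family of `n` distinct members of `S` is captured at level `l`. -/
def IsCapturing (τ : SchemeType) (𝓕 : Set (Finset Omega1)) (n : ℕ) : Prop :=
  ∀ S : Set FinOmega1, ¬ S.Countable →
    ∀ N : ℕ, ∃ l : ℕ, N ≤ l ∧ ∃ D : Fin n → FinOmega1, Function.Injective D ∧
      IsCapturedAt τ 𝓕 (fun i => (D i).1) l ∧ ∀ i, D i ∈ S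

/-! ### Forcing

A forcing notion is a nonempty preorder `P`; `q ≤ p` means that `q` is stronger than `p`.
A statement about the generic extension is represented by the set of conditions that force it.
The clauses for the connectives and quantifiers are the usual ones of the forcing relation. -/

namespace Forcing

/-- A statement of the forcing language, given by the conditions that force it. -/
abbrev Sentence (P : Type*) : Type _ := P → Prop

section Language

variable {P : Type*} [Preorder P]

/-- An absolute statement about ground model objects. -/
def check (b : Prop) : Sentence P := fun _ => b

def not (φ : Sentence P) : Sentence P := fun p => ∀ q ≤ p, ¬ φ q

def and (φ ψ : Sentence P) : Sentence P := fun p => φ p ∧ ψ p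

def imp (φ ψ : Sentence P) : Sentence P := fun p => ∀ q ≤ p, φ q → ψ q

def all {ι : Sort*} (φ : ι → Sentence P) : Sentence P := fun p => ∀ i, φ i p

def ex {ι : Sort*} (φ : ι → Sentence P) : Sentence P := fun p => ∀ q ≤ p, ∃ r ≤ q, ∃ i, φ i r

end Language

/-- A `P`-name for a subset of the ground model set `A`: a set of pairs `(a, p)` with `a ∈ A` and
`p ∈ P`, evaluated by a generic filter `G` as `{a | ∃ p ∈ G, (a, p) ∈ X}`. Every subset of `A` in
the generic extension has such a name. -/
abbrev SubsetName (P A : Type*) : Type _ := Set (A × P)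

section Names

variable {P A : Type*} [Preorder P]

/-- `a ∈ X`. -/
def mem (a : A) (X : SubsetName P A) : Sentence P :=
  fun p => ∀ q ≤ p, ∃ r ≤ q, ∃ s, (a, s) ∈ X ∧ r ≤ s

/-- `X` is countable: there is a (partial) function `g ⊆ ω × A` whose range contains `X`. -/
def countable (X : SubsetName P A) : Sentence P :=
  ex fun g : SubsetName P (ℕ × A) =>
    and
      (all fun k : ℕ => all fun a : A => all fun b : A =>
        imp (and (mem (k, a) g) (mem (k, b) g)) (check (a = b)))
      (all fun a : A => imp (mem a X) (ex fun k : ℕ => mem (k, a) g))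

end Names

/-- `P` is ccc: every set of pairwise incompatible conditions is countable. -/
def IsCCC (P : Type*) [Preorder P] : Prop :=
  ∀ A : Set P, IsStrongAntichain (· ≥ ·) A → A.Countable

/-- The statement that `𝓕` is `n`-capturing, in the forcing language of `P`. It is used for ccc
`P`, which preserve `ω₁`; being captured is absolute. -/
def capturing (P : Type*) [Preorder P] (τ : SchemeType) (𝓕 : Set (Finset Omega1)) (n : ℕ) :
    Sentence P :=
  all fun S : SubsetName P FinOmega1 => imp (not (countable S))
    (all fun N : ℕ => ex fun l : ℕ => and (check (N ≤ l))
      (ex fun D : Fin n → FinOmega1 => and (check (Function.Injective D))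
        (and (check (IsCapturedAt τ 𝓕 (fun i => (D i).1) l)) (all fun i => mem (D i) S))))

/-- `P` `n`-preserves `𝓕`: every condition forces that `𝓕` is `n`-capturing. -/
def Preserves (P : Type*) [Preorder P] (τ : SchemeType) (𝓕 : Set (Finset Omega1)) (n : ℕ) :
    Prop :=
  ∀ p : P, capturing P τ 𝓕 n p

/-- `D` is a dense set of conditions. -/
def IsDense {P : Type*} [Preorder P] (D : Set P) : Prop := ∀ p, ∃ q ≤ p, q ∈ D

/-- `𝔪(P)`, the least cardinality of a family of dense sets that no filter on `P` meets
simultaneously, and `⊤` if there is no such family. -/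
def martinNumber (P : Type) [Preorder P] : WithTop Cardinal.{0} :=
  sInf {κ | ∃ 𝒟 : Set (Set P), (∀ D ∈ 𝒟, IsDense D) ∧
    (¬ ∃ G : Order.PFilter P, ∀ D ∈ 𝒟, ∃ p ∈ D, p ∈ G) ∧
    κ = (Cardinal.mk 𝒟 : WithTop Cardinal.{0})}

end Forcing

open Classical in
/-- `𝔪ⁿ_𝓕`: the least `𝔪(P)` for a ccc forcing notion `P` that `n`-preserves `𝓕`, provided that
`𝓕` is `n`-capturing, and `ω` otherwise. -/
def schemeMartinNumber (τ : SchemeType) (𝓕 : Set (Finset Omega1)) (n : ℕ) :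
    WithTop Cardinal.{0} :=
  if IsCapturing τ 𝓕 n then
    sInf {x | ∃ (P : Type) (_ : Preorder P), Nonempty P ∧ Forcing.IsCCC P ∧
      Forcing.Preserves P τ 𝓕 n ∧ x = Forcing.martinNumber P}
  else (Cardinal.aleph0 : WithTop Cardinal.{0})

/-! ### Gaps -/

/-- `A ⊆* B`. -/
def AlmostSubset (A B : Set ℕ) : Prop := (A \ B).Finite

/-- `(𝓛, 𝓡)` is a pregap. -/
def IsPregap (𝓛 𝓡 : Set (Set ℕ)) : Prop := ∀ L ∈ 𝓛, ∀ R ∈ 𝓡, (L ∩ R).Finite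

/-- `C` separates `(𝓛, 𝓡)`. -/
def Separates (C : Set ℕ) (𝓛 𝓡 : Set (Set ℕ)) : Prop :=
  (∀ L ∈ 𝓛, AlmostSubset L C) ∧ ∀ R ∈ 𝓡, (C ∩ R).Finite

/-- `(𝓛, 𝓡)` is a gap: a pregap that no set separates. -/
def IsGap (𝓛 𝓡 : Set (Set ℕ)) : Prop := IsPregap 𝓛 𝓡 ∧ ¬ ∃ C, Separates C 𝓛 𝓡

/-- `(L_α, R_α)_{α < ω₁}` is an `(ω₁, ω₁)`-gap: both sequences increase with respect to `⊆*`,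
and together they form a gap. -/
structure IsOmega1Gap (L R : Omega1 → Set ℕ) : Prop where
  left_mono : ∀ α β, α ≤ β → AlmostSubset (L α) (L β)
  right_mono : ∀ α β, α ≤ β → AlmostSubset (R α) (R β)
  gap : IsGap (Set.range L) (Set.range R)

/-- The Hausdorff condition. -/
def HausdorffCondition (L R : Omega1 → Set ℕ) : Prop :=
  ∀ (β : Omega1) (k : ℕ), {α : Omega1 | α < β ∧ L β ∩ R α ⊆ Set.Iio k}.Finite

/-- An `(ω₁, ω₁)`-gap is levelwise-inseparable if `(L_{α+1} \ L_α, R_{α+1} \ R_α)_{α < ω₁}` is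
a gap. -/
def IsLevelwiseInseparable (L R : Omega1 → Set ℕ) : Prop :=
  IsOmega1Gap L R ∧
    IsGap (Set.range fun α => L (Order.succ α) \ L α) (Set.range fun α => R (Order.succ α) \ R α)

/-- `(L, R)` is weakly levelwise-inseparable if it has a levelwise-inseparable subgap. -/
def IsWeaklyLevelwiseInseparable (L R : Omega1 → Set ℕ) : Prop :=
  ∃ L' R' : Omega1 → Set ℕ, Set.range L' ⊆ Set.range L ∧ Set.range R' ⊆ Set.range R ∧
    IsLevelwiseInseparable L' R'

/-- `L_α = {2k + Ξ_α(k) : k ≥ 1, Ξ_α(k) ≥ 0}`. -/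
def schemeGapLeft (τ : SchemeType) (𝓕 : Set (Finset Omega1)) (α : Omega1) : Set ℕ :=
  {j | ∃ k : ℕ, 1 ≤ k ∧ 0 ≤ schemeXi τ 𝓕 α k ∧ (j : ℤ) = 2 * (k : ℤ) + schemeXi τ 𝓕 α k}

/-- `R_α = {2k + (1 - Ξ_α(k)) : k ≥ 1, Ξ_α(k) ≥ 0}`. -/
def schemeGapRight (τ : SchemeType) (𝓕 : Set (Finset Omega1)) (α : Omega1) : Set ℕ :=
  {j | ∃ k : ℕ, 1 ≤ k ∧ 0 ≤ schemeXi τ 𝓕 α k ∧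
    (j : ℤ) = 2 * (k : ℤ) + (1 - schemeXi τ 𝓕 α k)}

end

noncomputable section

/-! ### Levels of a construction scheme -/

/-! The block `{2k, 2k+1}` records the value `Ξ_α(k)`, and `ρ` controls how two records interact.
Above level `ρ(α, β)` the points lie in the same piece of a decomposition, so their nonnegative
values of `Ξ` agree; moreover, if the smaller point is off the root, so is the larger. This gives
finite intersections and monotonicity modulo finite sets. At level `ρ(α, β)` itself, with `α < β`,
the values are `0` and `1`, so `2ρ(α, β) + 1` lies in `L_β ∩ R_α`. Since only finitely many `α < β`
have `ρ(α, β)` below a given bound, Hausdorff's condition follows, and with it inseparability.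

For the last claim the main point is `exists_separates_diff`: for every `s : ω₁ → ω₁` a single set
separates all differences `L_{s(u)} \ L_u` from all `R_v`. The set is read off a filter on the poset
of finite approximations, provided that this poset is ccc and preserves `𝓕`. Both properties follow
once uncountably many conditions, paired with finite sets, contain two compatible conditions whose
finite sets are captured (`CapturesPairs`).

To find them, fix the isomorphism type and capture the supports at a high level `l`. A conflict
between the two conditions at some `n` is impossible. If `n / 2 < l`, then `Ξ` agrees at equal
positions, so the conflict would already occur in one condition. If `n / 2 = l`, then `Ξ` is
constant on each tail and `-1` on the root, so the differences contain nothing at this level; this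
is where differences are needed instead of full left sides. If `n / 2 > l`, then all supports lie in
one member of `𝓕_l`, where `L` and `R` no longer meet. This is
`GapForcing.exists_le_of_isCapturedPair`.

A levelwise-inseparable subgap is then refuted by an `s` that sends the index of `L'_α` to the index
of `L'_{α+1}`. -/

instance : Infinite Omega1 := by
  rw [Cardinal.infinite_iff]
  simp

instance : Uncountable Omega1 := by
  rw [← Cardinal.aleph0_lt_mk_iff]
  simp

lemma SchemeType.m_strictMono (τ : SchemeType) : StrictMono τ.m := by
  refine strictMono_nat_of_lt_succ fun k => ?_
  have h1 := τ.r_lt_m k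
  have h2 : (τ.m k - τ.r (k + 1)) * 2 ≤ (τ.m k - τ.r (k + 1)) * τ.n (k + 1) :=
    Nat.mul_le_mul_left _ (τ.two_le_n k)
  rw [τ.m_succ k]
  omega

namespace IsConstructionScheme

variable {τ : SchemeType} {𝓕 : Set (Finset Omega1)}

/-- Padding `A` to at least `m_k` points before applying cofinality forces the level up to `k`,
because `m` is strictly increasing. -/
lemma exists_level_superset (h : IsConstructionScheme τ 𝓕) (A : Finset Omega1) (k : ℕ) :
    ∃ j ≥ k, ∃ E ∈ schemeLevel τ 𝓕 j, A ⊆ E := by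
  obtain ⟨B, hAB, hB⟩ := Infinite.exists_superset_card_eq A (max A.card (τ.m k)) (le_max_left _ _)
  have hpos : 0 < τ.m k := (Nat.zero_le _).trans_lt (τ.r_lt_m k)
  have hBne : B.Nonempty := by
    rw [← Finset.card_pos, hB]
    exact lt_max_of_lt_right hpos
  obtain ⟨E, hE, hBE⟩ := h.cofinal B hBne
  obtain ⟨j, hj⟩ := h.card_mem E hE
  refine ⟨j, ?_, E, ⟨hE, hj⟩, hAB.trans hBE⟩
  have := Finset.card_le_card hBE
  rw [hB, hj] at this
  exact τ.m_strictMono.le_iff_le.1 ((le_max_right _ _).trans this)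

lemma exists_level_subset (h : IsConstructionScheme τ 𝓕) {k j : ℕ} (hkj : k ≤ j)
    {E : Finset Omega1} (hE : E ∈ schemeLevel τ 𝓕 j) {α : Omega1} (hα : α ∈ E) :
    ∃ E' ∈ schemeLevel τ 𝓕 k, α ∈ E' ∧ E' ⊆ E := by
  induction j, hkj using Nat.le_induction generalizing E with
  | base => exact ⟨E, hE, hα, subset_rfl⟩
  | succ j hj ih =>
    obtain ⟨D, R, hD⟩ := h.decomposition j E hE
    have hα' := hα
    rw [hD.eq_union, Finset.mem_biUnion] at hα'
    obtain ⟨i, -, hi⟩ := hα'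
    obtain ⟨E', hE', hαE', hsub⟩ := ih (hD.mem_level i) hi
    refine ⟨E', hE', hαE', hsub.trans ?_⟩
    rw [hD.eq_union]
    exact Finset.subset_biUnion_of_mem D (Finset.mem_univ i)

lemma exists_level_mem (h : IsConstructionScheme τ 𝓕) (α : Omega1) (k : ℕ) :
    ∃ E ∈ schemeLevel τ 𝓕 k, α ∈ E := by
  obtain ⟨j, hj, E, hE, hα⟩ := h.exists_level_superset {α} k
  obtain ⟨E', hE', hα', -⟩ := h.exists_level_subset hj hE (hα (Finset.mem_singleton_self α))
  exact ⟨E', hE', hα'⟩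

lemma exists_level_rho (h : IsConstructionScheme τ 𝓕) (α β : Omega1) :
    ∃ E ∈ schemeLevel τ 𝓕 (schemeRho τ 𝓕 α β), α ∈ E ∧ β ∈ E := by
  have : {k : ℕ | ∃ E ∈ schemeLevel τ 𝓕 k, α ∈ E ∧ β ∈ E}.Nonempty := by
    obtain ⟨j, -, E, hE, hs⟩ := h.exists_level_superset {α, β} 0
    exact ⟨j, E, hE, hs (by simp), hs (by simp)⟩
  exact Nat.sInf_mem this

end IsConstructionScheme

section Rho

variable {τ : SchemeType} {𝓕 : Set (Finset Omega1)}

lemma schemeRho_comm (α β : Omega1) : schemeRho τ 𝓕 α β = schemeRho τ 𝓕 β α := by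
  unfold schemeRho
  congr 1
  ext k
  simp only [Set.mem_ofPred_eq, and_comm]

lemma schemeRho_le {k : ℕ} {E : Finset Omega1} (hE : E ∈ schemeLevel τ 𝓕 k) {α β : Omega1}
    (hα : α ∈ E) (hβ : β ∈ E) : schemeRho τ 𝓕 α β ≤ k :=
  Nat.sInf_le ⟨E, hE, hα, hβ⟩

end Rho

namespace IsConstructionScheme

variable {τ : SchemeType} {𝓕 : Set (Finset Omega1)}

/-- Shrink `E` around `β` to a member of level `ρ(α, β)`. It meets the member witnessing `ρ(α, β)`
in an initial segment containing `β`, hence also `α`. -/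
lemma mem_of_rho_le (h : IsConstructionScheme τ 𝓕) {k : ℕ} {E : Finset Omega1}
    (hE : E ∈ schemeLevel τ 𝓕 k) {α β : Omega1} (hβ : β ∈ E) (hαβ : α ≤ β)
    (hρ : schemeRho τ 𝓕 α β ≤ k) : α ∈ E := by
  obtain ⟨E₀, hE₀, hα₀, hβ₀⟩ := h.exists_level_rho α β
  obtain ⟨E', hE', hβ', hsub⟩ := h.exists_level_subset hρ hE hβ
  have := (h.inter_initial _ E' hE' E₀ hE₀).2.2 β (Finset.mem_inter.2 ⟨hβ', hβ₀⟩) α hα₀ hαβ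
  exact hsub (Finset.mem_inter.1 this).1

/-- The position of `α` therefore does not depend on the chosen member of `𝓕_k`. -/
lemma norm_eq_card (h : IsConstructionScheme τ 𝓕) {k : ℕ} {E : Finset Omega1}
    (hE : E ∈ schemeLevel τ 𝓕 k) {α : Omega1} (hα : α ∈ E) :
    schemeNorm τ 𝓕 α k = (E.filter (· < α)).card := by
  unfold schemeNorm
  rw [← Set.ncard_coe_finset]
  congr 1
  ext ξ
  simp only [Set.mem_ofPred_eq, Finset.coe_filter]
  constructor
  · rintro ⟨h1, h2⟩
    rw [schemeRho_comm] at h2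
    exact ⟨h.mem_of_rho_le hE hα h1.le h2, h1⟩
  · rintro ⟨h1, h2⟩
    exact ⟨h2, schemeRho_le hE hα h1⟩

lemma finite_rho_le (h : IsConstructionScheme τ 𝓕) (β : Omega1) (k : ℕ) :
    {α | α < β ∧ schemeRho τ 𝓕 α β ≤ k}.Finite := by
  obtain ⟨E, hE, hβ⟩ := h.exists_level_mem β k
  exact E.finite_toSet.subset fun α hα => h.mem_of_rho_le hE hβ hα.1.le hα.2

/-- All members of a finite set lie in a common member of the `l`-th level as soon as this is so
for their maximum and `ρ` is at most `l` between each of them and the maximum. -/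
lemma subset_level_of_subset_level (h : IsConstructionScheme τ 𝓕) {k l : ℕ} (hkl : k ≤ l)
    {A E₀ E : Finset Omega1} (hE₀ : E₀ ∈ schemeLevel τ 𝓕 k) (hA : A ⊆ E₀)
    (hE : E ∈ schemeLevel τ 𝓕 l) {t : Omega1} (htA : t ∈ A) (ht : ∀ a ∈ A, a ≤ t) (htE : t ∈ E) :
    A ⊆ E := fun a ha =>
  h.mem_of_rho_le hE htE (ht a ha) ((schemeRho_le hE₀ (hA ha) (hA htA)).trans hkl)

end IsConstructionScheme

/-! ### Pieces of canonical decompositions and the values of `Ξ`. -/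

namespace IsCanonicalDecomposition

variable {τ : SchemeType} {𝓕 : Set (Finset Omega1)} {k : ℕ} {E R : Finset Omega1}
  {D : Fin (τ.n (k + 1)) → Finset Omega1}

lemma root_subset (hD : IsCanonicalDecomposition τ 𝓕 k E D R) (i : Fin (τ.n (k + 1))) :
    R ⊆ D i := by
  have : Nontrivial (Fin (τ.n (k + 1))) := Fin.nontrivial_iff_two_le.2 (τ.two_le_n k)
  obtain ⟨j, hj⟩ := exists_ne i
  rw [← hD.inter_eq i j hj.symm]
  exact Finset.inter_subset_left

lemma mem_iff (hD : IsCanonicalDecomposition τ 𝓕 k E D R) {α : Omega1} :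
    α ∈ E ↔ ∃ i, α ∈ D i := by
  rw [hD.eq_union]
  simp

lemma mem_root_of_le (hD : IsCanonicalDecomposition τ 𝓕 k E D R) {α β : Omega1} (hα : α ∈ E)
    (hβ : β ∈ R) (hαβ : α ≤ β) : α ∈ R := by
  obtain ⟨i, hi⟩ := hD.mem_iff.1 hα
  by_contra hαR
  exact absurd (hD.root_before i β hβ α (Finset.mem_sdiff.2 ⟨hi, hαR⟩)) hαβ.not_gt

lemma card_filter_lt_root (hD : IsCanonicalDecomposition τ 𝓕 k E D R) {α : Omega1} (hα : α ∈ E) :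
    (E.filter (· < α)).card < τ.r (k + 1) ↔ α ∈ R := by
  constructor
  · intro hlt
    by_contra hαR
    obtain ⟨i, hi⟩ := hD.mem_iff.1 hα
    refine hlt.not_ge ?_
    rw [← hD.card_root]
    refine Finset.card_le_card fun ξ hξ => Finset.mem_filter.2 ⟨hD.mem_iff.2 ⟨i, ?_⟩, ?_⟩
    · exact hD.root_subset i hξ
    · exact hD.root_before i ξ hξ α (Finset.mem_sdiff.2 ⟨hi, hαR⟩)
  · intro hαR
    rw [← hD.card_root]
    refine Finset.card_lt_card ⟨fun ξ hξ => ?_, fun hsub => ?_⟩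
    · rw [Finset.mem_filter] at hξ
      exact hD.mem_root_of_le hξ.1 hαR hξ.2.le
    · exact lt_irrefl _ (Finset.mem_filter.1 (hsub hαR)).2

/-- For `n_{k+1} = 2`, the piece containing a point outside the root is determined by the number
of its predecessors. -/
lemma card_filter_lt_tail (hD : IsCanonicalDecomposition τ 𝓕 k E D R) (htwo : τ.n (k + 1) = 2)
    {α : Omega1} {i : Fin (τ.n (k + 1))} (hα : α ∈ D i \ R) :
    (i : ℕ) = if (E.filter (· < α)).card < τ.m k then 0 else 1 := by
  have hi : (i : ℕ) < 2 := htwo ▸ i.2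
  have hmem := Finset.mem_sdiff.1 hα
  have hcard : ∀ j, (D j).card = τ.m k := fun j => (hD.mem_level j).2
  rcases (by omega : (i : ℕ) = 0 ∨ (i : ℕ) = 1) with h0 | h1
  · rw [if_pos, h0]
    rw [← hcard i]
    refine Finset.card_lt_card ⟨fun ξ hξ => ?_, fun hsub => ?_⟩
    · rw [Finset.mem_filter] at hξ
      obtain ⟨j, hj⟩ := hD.mem_iff.1 hξ.1
      by_cases hξR : ξ ∈ R
      · exact hD.root_subset i hξR
      · have hji : ¬ i < j := fun hij =>
          lt_asymm hξ.2 (hD.tails i j hij α hα ξ (Finset.mem_sdiff.2 ⟨hj, hξR⟩))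
        have : j = i := by
          rw [Fin.lt_def] at hji
          ext
          omega
        exact this ▸ hj
    · exact lt_irrefl _ (Finset.mem_filter.1 (hsub hmem.1)).2
  · rw [if_neg, h1]
    rw [not_lt]
    set j : Fin (τ.n (k + 1)) := ⟨0, by omega⟩
    rw [← hcard j]
    refine Finset.card_le_card fun ξ hξ => Finset.mem_filter.2 ⟨hD.mem_iff.2 ⟨j, hξ⟩, ?_⟩
    by_cases hξR : ξ ∈ R
    · exact hD.root_before i ξ hξR α hα
    · exact hD.tails j i (by rw [Fin.lt_def]; simp [j, h1]) ξ (Finset.mem_sdiff.2 ⟨hξ, hξR⟩) α hα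

end IsCanonicalDecomposition

namespace IsConstructionScheme

variable {τ : SchemeType} {𝓕 : Set (Finset Omega1)}

/-- Root, first tail and second tail are consecutive intervals of `E` of known sizes, so the
position of `α` decides among them. This makes the choice in `schemeXi` harmless and lets `Δ`
control `Ξ`. -/
lemma xi_succ_eq (h : IsConstructionScheme τ 𝓕) {k : ℕ} (htwo : τ.n (k + 1) = 2) (α : Omega1) :
    schemeXi τ 𝓕 α (k + 1) = if schemeNorm τ 𝓕 α (k + 1) < τ.r (k + 1) then -1
      else if schemeNorm τ 𝓕 α (k + 1) < τ.m k then 0 else 1 := by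
  obtain ⟨E₀, hE₀, hα₀⟩ := h.exists_level_mem α (k + 1)
  obtain ⟨D₀, R₀, hD₀⟩ := h.decomposition k E₀ hE₀
  obtain ⟨i₀, hi₀⟩ := hD₀.mem_iff.1 hα₀
  have hr₀ := hD₀.card_filter_lt_root hα₀
  rw [← h.norm_eq_card hE₀ hα₀] at hr₀
  by_cases hex : ∃ i : Fin (τ.n (k + 1)), ∃ E ∈ schemeLevel τ 𝓕 (k + 1), ∃ D R,
      IsCanonicalDecomposition τ 𝓕 k E D R ∧ α ∈ D i \ R
  · rw [schemeXi, dif_pos hex]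
    obtain ⟨E, hE, D, R, hD, hα⟩ := hex.choose_spec
    have hαE : α ∈ E := hD.mem_iff.2 ⟨_, (Finset.mem_sdiff.1 hα).1⟩
    have hr := hD.card_filter_lt_root hαE
    have ht := hD.card_filter_lt_tail htwo hα
    rw [← h.norm_eq_card hE hαE] at hr ht
    rw [if_neg fun h1 => (Finset.mem_sdiff.1 hα).2 (hr.1 h1), ht]
    split_ifs <;> rfl
  · rw [schemeXi, dif_neg hex, if_pos]
    by_contra hlt
    exact hex ⟨i₀, E₀, hE₀, D₀, R₀, hD₀, Finset.mem_sdiff.2 ⟨hi₀, fun hR => hlt (hr₀.2 hR)⟩⟩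

lemma xi_eq_of_mem (h : IsConstructionScheme τ 𝓕) {k : ℕ} (htwo : τ.n (k + 1) = 2)
    {E R : Finset Omega1} {D : Fin (τ.n (k + 1)) → Finset Omega1}
    (hE : E ∈ schemeLevel τ 𝓕 (k + 1)) (hD : IsCanonicalDecomposition τ 𝓕 k E D R) {α : Omega1}
    {i : Fin (τ.n (k + 1))} (hα : α ∈ D i) :
    schemeXi τ 𝓕 α (k + 1) = if α ∈ R then -1 else (i : ℤ) := by
  have hαE : α ∈ E := hD.mem_iff.2 ⟨i, hα⟩
  have hr := hD.card_filter_lt_root hαE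
  rw [h.xi_succ_eq htwo, h.norm_eq_card hE hαE]
  by_cases hR : α ∈ R
  · rw [if_pos (hr.2 hR), if_pos hR]
  · rw [if_neg (mt hr.1 hR), if_neg hR,
      hD.card_filter_lt_tail htwo (Finset.mem_sdiff.2 ⟨hα, hR⟩)]
    split_ifs <;> rfl

lemma xi_eq_or (h : IsConstructionScheme τ 𝓕) (htwo : ∀ k, τ.n (k + 1) = 2) (α : Omega1) (k : ℕ) :
    schemeXi τ 𝓕 α k = -1 ∨ schemeXi τ 𝓕 α k = 0 ∨ schemeXi τ 𝓕 α k = 1 := by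
  cases k with
  | zero => exact Or.inr (Or.inl rfl)
  | succ k =>
    rw [h.xi_succ_eq (htwo k)]
    split_ifs <;> simp

lemma xi_eq_of_norm_eq (h : IsConstructionScheme τ 𝓕) (htwo : ∀ k, τ.n (k + 1) = 2)
    {α β : Omega1} {k : ℕ} (hn : schemeNorm τ 𝓕 α k = schemeNorm τ 𝓕 β k) :
    schemeXi τ 𝓕 α k = schemeXi τ 𝓕 β k := by
  cases k with
  | zero => rfl
  | succ k => rw [h.xi_succ_eq (htwo k), h.xi_succ_eq (htwo k), hn]

/-- A piece containing `β` also contains `α`, since its level is at least `ρ(α, β)`. The root is an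
initial segment, so it omits `β` whenever it omits the smaller `α`; the converse may fail. -/
lemma xi_of_rho_lt (h : IsConstructionScheme τ 𝓕) (htwo : ∀ k, τ.n (k + 1) = 2)
    {α β : Omega1} (hαβ : α ≤ β) {k : ℕ} (hk : schemeRho τ 𝓕 α β < k)
    (hα : 0 ≤ schemeXi τ 𝓕 α k) : schemeXi τ 𝓕 β k = schemeXi τ 𝓕 α k := by
  obtain ⟨k, rfl⟩ : ∃ j, k = j + 1 := ⟨k - 1, by omega⟩
  obtain ⟨E, hE, hβE⟩ := h.exists_level_mem β (k + 1)
  obtain ⟨D, R, hD⟩ := h.decomposition k E hE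
  obtain ⟨i, hi⟩ := hD.mem_iff.1 hβE
  have hiα := h.mem_of_rho_le (hD.mem_level i) hi hαβ (Nat.lt_succ_iff.1 hk)
  have h1 := h.xi_eq_of_mem (htwo k) hE hD hi
  have h2 := h.xi_eq_of_mem (htwo k) hE hD hiα
  have hαR : α ∉ R := by
    intro hR
    rw [h2, if_pos hR] at hα
    omega
  rw [h1, h2, if_neg hαR, if_neg fun hR => hαR (hD.mem_root_of_le (hD.mem_iff.2 ⟨i, hiα⟩) hR hαβ)]

lemma xi_eq_of_rho_lt (h : IsConstructionScheme τ 𝓕) (htwo : ∀ k, τ.n (k + 1) = 2)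
    {α β : Omega1} {k : ℕ} (hk : schemeRho τ 𝓕 α β < k)
    (hα : 0 ≤ schemeXi τ 𝓕 α k) (hβ : 0 ≤ schemeXi τ 𝓕 β k) :
    schemeXi τ 𝓕 α k = schemeXi τ 𝓕 β k := by
  rcases le_total α β with hle | hle
  · exact (h.xi_of_rho_lt htwo hle hk hα).symm
  · exact h.xi_of_rho_lt htwo hle (by rwa [schemeRho_comm]) hβ

/-- By minimality of `ρ` no single piece contains both points, so neither is in the root and they
lie in different tails, ordered like the points. -/
lemma xi_rho (h : IsConstructionScheme τ 𝓕) (htwo : ∀ k, τ.n (k + 1) = 2)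
    {α β : Omega1} (hαβ : α < β) :
    1 ≤ schemeRho τ 𝓕 α β ∧ schemeXi τ 𝓕 α (schemeRho τ 𝓕 α β) = 0 ∧
      schemeXi τ 𝓕 β (schemeRho τ 𝓕 α β) = 1 := by
  obtain ⟨E, hE, hαE, hβE⟩ := h.exists_level_rho α β
  rcases hρ : schemeRho τ 𝓕 α β with _ | k
  · rw [hρ] at hE
    have hc : E.card ≤ 1 := (hE.2.trans τ.m_zero).le
    exact absurd (Finset.card_le_one.1 hc α hαE β hβE) hαβ.ne
  · rw [hρ] at hE
    obtain ⟨D, R, hD⟩ := h.decomposition k E hE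
    obtain ⟨i, hi⟩ := hD.mem_iff.1 hαE
    obtain ⟨j, hj⟩ := hD.mem_iff.1 hβE
    have hnot : ∀ i, ¬ (α ∈ D i ∧ β ∈ D i) := fun i hi => by
      have := schemeRho_le (hD.mem_level i) hi.1 hi.2
      omega
    have hαR : α ∉ R := fun hR => hnot j ⟨hD.root_subset j hR, hj⟩
    have hβR : β ∉ R := fun hR => hnot i ⟨hi, hD.root_subset i hR⟩
    have hij : (i : ℕ) < j := by
      by_contra hlt
      rcases eq_or_ne i j with rfl | hne
      · exact hnot i ⟨hi, hj⟩
      · refine lt_asymm hαβ (hD.tails j i ?_ β (Finset.mem_sdiff.2 ⟨hj, hβR⟩) α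
          (Finset.mem_sdiff.2 ⟨hi, hαR⟩))
        rw [Fin.lt_def]
        have := Fin.val_ne_of_ne hne
        omega
    have hj2 : (j : ℕ) < 2 := htwo k ▸ j.2
    rw [h.xi_eq_of_mem (htwo k) hE hD hi, h.xi_eq_of_mem (htwo k) hE hD hj, if_neg hαR, if_neg hβR]
    omega

end IsConstructionScheme

/-! ### The gap -/

section Gap

variable {τ : SchemeType} {𝓕 : Set (Finset Omega1)}

lemma mem_schemeGapLeft (h : IsConstructionScheme τ 𝓕) (htwo : ∀ k, τ.n (k + 1) = 2)
    {α : Omega1} {n : ℕ} :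
    n ∈ schemeGapLeft τ 𝓕 α ↔ 1 ≤ n / 2 ∧ schemeXi τ 𝓕 α (n / 2) = ((n % 2 : ℕ) : ℤ) := by
  constructor
  · rintro ⟨k, hk, h0, hn⟩
    have hx := h.xi_eq_or htwo α k
    obtain rfl : n / 2 = k := by omega
    omega
  · rintro ⟨h1, h2⟩
    exact ⟨n / 2, h1, by omega, by omega⟩

lemma mem_schemeGapRight (h : IsConstructionScheme τ 𝓕) (htwo : ∀ k, τ.n (k + 1) = 2)
    {α : Omega1} {n : ℕ} :
    n ∈ schemeGapRight τ 𝓕 α ↔ 1 ≤ n / 2 ∧ schemeXi τ 𝓕 α (n / 2) = 1 - ((n % 2 : ℕ) : ℤ) := by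
  constructor
  · rintro ⟨k, hk, h0, hn⟩
    have hx := h.xi_eq_or htwo α k
    obtain rfl : n / 2 = k := by omega
    omega
  · rintro ⟨h1, h2⟩
    exact ⟨n / 2, h1, by omega, by omega⟩

lemma le_rho_of_mem_left_right (h : IsConstructionScheme τ 𝓕) (htwo : ∀ k, τ.n (k + 1) = 2)
    {α β : Omega1} {n : ℕ} (hL : n ∈ schemeGapLeft τ 𝓕 α) (hR : n ∈ schemeGapRight τ 𝓕 β) :
    n / 2 ≤ schemeRho τ 𝓕 α β := by
  rw [mem_schemeGapLeft h htwo] at hL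
  rw [mem_schemeGapRight h htwo] at hR
  by_contra! hlt
  have := h.xi_eq_of_rho_lt htwo hlt (by omega) (by omega)
  omega

lemma finite_left_inter_right (h : IsConstructionScheme τ 𝓕) (htwo : ∀ k, τ.n (k + 1) = 2)
    (α β : Omega1) : (schemeGapLeft τ 𝓕 α ∩ schemeGapRight τ 𝓕 β).Finite := by
  refine (Set.finite_Iio (2 * schemeRho τ 𝓕 α β + 2)).subset fun n hn => ?_
  have := le_rho_of_mem_left_right h htwo hn.1 hn.2
  rw [Set.mem_Iio]
  omega

/-- The number `2ρ(α, β) + 1` lies in `L_β ∩ R_α`, so a bound on this intersection bounds `ρ(α, β)`.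
-/
lemma hausdorffCondition_schemeGap (h : IsConstructionScheme τ 𝓕) (htwo : ∀ k, τ.n (k + 1) = 2) :
    HausdorffCondition (schemeGapLeft τ 𝓕) (schemeGapRight τ 𝓕) := by
  intro β k
  refine (h.finite_rho_le β k).subset fun α ⟨hα, hsub⟩ => ⟨hα, ?_⟩
  obtain ⟨h1, h2, h3⟩ := h.xi_rho htwo hα
  have hmem : 2 * schemeRho τ 𝓕 α β + 1 ∈ schemeGapLeft τ 𝓕 β ∩ schemeGapRight τ 𝓕 α := by
    refine ⟨⟨_, h1, by omega, by rw [h3]; push_cast; ring⟩,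
      ⟨_, h1, by omega, by rw [h2]; push_cast; ring⟩⟩
  have := hsub hmem
  rw [Set.mem_Iio] at this
  omega

/-- A Hausdorff pair of `ω₁`-sequences cannot be separated. -/
lemma HausdorffCondition.not_separates {L R : Omega1 → Set ℕ} (hH : HausdorffCondition L R) :
    ¬ ∃ C, Separates C (Set.range L) (Set.range R) := by
  rintro ⟨C, hL, hR⟩
  have hbound : ∀ α, ∃ n, L α \ C ⊆ Set.Iio n ∧ C ∩ R α ⊆ Set.Iio n := by
    intro α
    obtain ⟨n, hn⟩ := ((hL _ ⟨α, rfl⟩).union (hR _ ⟨α, rfl⟩)).bddAbove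
    refine ⟨n + 1, fun x hx => Nat.lt_succ_of_le (hn (Or.inl hx)),
      fun x hx => Nat.lt_succ_of_le (hn (Or.inr hx))⟩
  choose f hf using hbound
  -- One error bound `n` serves uncountably many indices. Within this fibre Hausdorff's condition
  -- leaves finitely many predecessors to each point, and counting them embeds the fibre into `ℕ`.
  obtain ⟨n, hn⟩ : ∃ n, ¬ (f ⁻¹' {n}).Countable := by
    by_contra! hc
    refine Set.not_countable_univ (α := Omega1) ?_
    rw [← Set.preimage_univ (f := f), ← Set.iUnion_of_singleton, Set.preimage_iUnion]
    exact Set.countable_iUnion hc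
  have hfin : ∀ β ∈ f ⁻¹' {n}, {α | α ∈ f ⁻¹' {n} ∧ α < β}.Finite := by
    intro β hβ
    refine (hH β n).subset fun α ⟨hα, hlt⟩ => ⟨hlt, fun x hx => ?_⟩
    rw [Set.mem_preimage, Set.mem_singleton_iff] at hα hβ
    by_cases hxC : x ∈ C
    · exact hα ▸ (hf α).2 ⟨hxC, hx.2⟩
    · exact hβ ▸ (hf β).1 ⟨hx.1, hxC⟩
  refine hn (Set.countable_iff_exists_injOn.2
    ⟨fun β => {α | α ∈ f ⁻¹' {n} ∧ α < β}.ncard, StrictMonoOn.injOn fun α hα β hβ hlt => ?_⟩)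
  refine Set.ncard_lt_ncard ⟨fun ξ hξ => ⟨hξ.1, hξ.2.trans hlt⟩, fun hsub => ?_⟩ (hfin β hβ)
  exact lt_irrefl _ (hsub ⟨hα, hlt⟩ : α ∈ f ⁻¹' {n} ∧ α < α).2

lemma isOmega1Gap_schemeGap (h : IsConstructionScheme τ 𝓕) (htwo : ∀ k, τ.n (k + 1) = 2) :
    IsOmega1Gap (schemeGapLeft τ 𝓕) (schemeGapRight τ 𝓕) where
  left_mono α β hαβ := by
    refine (Set.finite_Iio (2 * schemeRho τ 𝓕 α β + 2)).subset fun n ⟨h1, h2⟩ => ?_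
    rw [mem_schemeGapLeft h htwo] at h1 h2
    rw [Set.mem_Iio]
    by_contra! hlt
    exact h2 ⟨h1.1, (h.xi_of_rho_lt htwo hαβ (by omega) (by omega)).trans h1.2⟩
  right_mono α β hαβ := by
    refine (Set.finite_Iio (2 * schemeRho τ 𝓕 α β + 2)).subset fun n ⟨h1, h2⟩ => ?_
    rw [mem_schemeGapRight h htwo] at h1 h2
    rw [Set.mem_Iio]
    by_contra! hlt
    exact h2 ⟨h1.1, (h.xi_of_rho_lt htwo hαβ (by omega) (by omega)).trans h1.2⟩
  gap := by
    refine ⟨?_, (hausdorffCondition_schemeGap h htwo).not_separates⟩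
    rintro _ ⟨α, rfl⟩ _ ⟨β, rfl⟩
    exact finite_left_inter_right h htwo α β

end Gap

/-! ### Positions in finite sets and captured pairs -/

/-- The index of `z` in the increasing enumeration of `A`. -/
def Finset.position {α : Type*} [LinearOrder α] (A : Finset α) (z : α) : ℕ :=
  (A.filter (· < z)).card

namespace Finset

section Position

variable {α : Type*} [LinearOrder α]

lemma strictMonoOn_position (A : Finset α) : StrictMonoOn A.position A := by
  intro x hx y _ hxy
  refine card_lt_card ⟨fun z hz => ?_, fun hsub => ?_⟩
  · rw [mem_filter] at hz ⊢
    exact ⟨hz.1, hz.2.trans hxy⟩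
  · exact lt_irrefl _ (mem_filter.1 (hsub (mem_filter.2 ⟨hx, hxy⟩))).2

lemma position_inj {A : Finset α} {x y : α} (hx : x ∈ A) (hy : y ∈ A)
    (h : A.position x = A.position y) : x = y :=
  A.strictMonoOn_position.injOn hx hy h

lemma position_lt_card {A : Finset α} {x : α} (hx : x ∈ A) : A.position x < A.card :=
  card_lt_card ⟨filter_subset _ _, fun hsub => lt_irrefl _ (mem_filter.1 (hsub hx)).2⟩

lemma position_orderEmbOfFin (A : Finset α) {m : ℕ} (h : A.card = m) (a : Fin m) :
    A.position (A.orderEmbOfFin h a) = a := by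
  have : A.filter (· < A.orderEmbOfFin h a) = (Finset.Iio a).image (A.orderEmbOfFin h) := by
    ext x
    simp only [mem_filter, mem_image, mem_Iio]
    constructor
    · rintro ⟨hx, hlt⟩
      rw [← mem_coe, ← range_orderEmbOfFin A h] at hx
      obtain ⟨b, rfl⟩ := hx
      exact ⟨b, (A.orderEmbOfFin h).lt_iff_lt.1 hlt, rfl⟩
    · rintro ⟨b, hb, rfl⟩
      exact ⟨orderEmbOfFin_mem _ _ _, (A.orderEmbOfFin h).lt_iff_lt.2 hb⟩
  rw [position, this, card_image_of_injective _ (A.orderEmbOfFin h).injective, Fin.card_Iio]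

lemma orderEmbOfFin_position {A : Finset α} {m : ℕ} (h : A.card = m) {x : α} (hx : x ∈ A) :
    A.orderEmbOfFin h ⟨A.position x, h ▸ position_lt_card hx⟩ = x :=
  position_inj (orderEmbOfFin_mem _ _ _) hx (position_orderEmbOfFin _ _ _)

end Position

lemma Before.position_eq {R A : Finset Omega1} (hRA : R ⊆ A) (h : R.Before (A \ R)) {z : Omega1}
    (hz : z ∈ R) : A.position z = R.position z := by
  unfold position
  congr 1
  ext x
  simp only [mem_filter]
  refine ⟨fun ⟨hx, hlt⟩ => ⟨?_, hlt⟩, fun ⟨hx, hlt⟩ => ⟨hRA hx, hlt⟩⟩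
  by_contra hxR
  exact lt_asymm hlt (h z hz x (mem_sdiff.2 ⟨hx, hxR⟩))

lemma Before.position_lt_card_iff {R A : Finset Omega1} (hRA : R ⊆ A) (h : R.Before (A \ R))
    {z : Omega1} (hz : z ∈ A) : A.position z < R.card ↔ z ∈ R := by
  constructor
  · intro hlt
    by_contra hzR
    refine hlt.not_ge (card_le_card fun x hx => mem_filter.2 ⟨hRA hx, ?_⟩)
    exact h x hx z (mem_sdiff.2 ⟨hz, hzR⟩)
  · intro hzR
    rw [h.position_eq hRA hzR]
    exact position_lt_card hzR

end Finset

lemma schemeNorm_eq_of_lt_delta {τ : SchemeType} {𝓕 : Set (Finset Omega1)} {α β : Omega1} {k : ℕ}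
    (h : (k : ℕ∞) < schemeDelta τ 𝓕 α β) : schemeNorm τ 𝓕 α k = schemeNorm τ 𝓕 β k := by
  by_contra hne
  exact h.not_ge (sInf_le ⟨k, hne, rfl⟩)

/-- Captured pairs, in terms of positions. -/
structure IsCapturedPair (τ : SchemeType) (𝓕 : Set (Finset Omega1)) (D : Fin 2 → Finset Omega1)
    (R : Finset Omega1) (l : ℕ) : Prop where
  rootTailTail : IsRootTailTail D R
  card_eq : (D 0).card = (D 1).card
  xi_eq : ∀ i, ∀ z ∈ D i, schemeXi τ 𝓕 z l = if z ∈ R then -1 else ((i : ℕ) : ℤ)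
  rho_delta : ∀ u ∈ D 0, ∀ v ∈ D 1, (D 0).position u = (D 1).position v → u ∉ R →
    schemeRho τ 𝓕 u v = l ∧ schemeDelta τ 𝓕 u v = (l : ℕ∞)

section Captured

variable {τ : SchemeType} {𝓕 : Set (Finset Omega1)} {D : Fin 2 → Finset Omega1}
  {R : Finset Omega1} {l : ℕ}

/-- The root is an initial segment of both sets, so a root point has the same position in each. -/
lemma IsRootTailTail.eq_of_mem_root (h : IsRootTailTail D R) {i j : Fin 2} {u v : Omega1}
    (hu : u ∈ R) (hv : v ∈ D j) (huv : (D i).position u = (D j).position v) : u = v := by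
  refine Finset.position_inj (h.root_subset j hu) hv ?_
  rw [← huv, (h.root_before i).position_eq (h.root_subset i) hu,
    (h.root_before j).position_eq (h.root_subset j) hu]

lemma IsCapturedAt.exists_isCapturedPair (h : IsCapturedAt τ 𝓕 D l) :
    ∃ R, IsCapturedPair τ 𝓕 D R l := by
  obtain ⟨m, hm, R, -, hR, hxi, hpair⟩ := h
  refine ⟨R, hR, by rw [hm, hm], fun i z hz => ?_, fun u hu v hv huv huR => ?_⟩
  · have := hxi i ⟨(D i).position z, hm i ▸ Finset.position_lt_card hz⟩
    rw [Finset.orderEmbOfFin_position (hm i) hz] at this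
    rw [this]
    exact if_congr ((hR.root_before i).position_lt_card_iff (hR.root_subset i) hz) rfl rfl
  · have hle : R.card ≤ (D 0).position u := by
      by_contra! hlt
      exact huR (((hR.root_before 0).position_lt_card_iff (hR.root_subset 0) hu).1 hlt)
    have := hpair 0 1 ⟨(D 0).position u, hm 0 ▸ Finset.position_lt_card hu⟩ (by decide) hle
    rw [Finset.orderEmbOfFin_position (hm 0) hu] at this
    simp only [huv] at this
    rwa [Finset.orderEmbOfFin_position (hm 1) hv] at this

namespace IsCapturedPair

lemma norm_eq (h : IsCapturedPair τ 𝓕 D R l) {i j : Fin 2} {u v : Omega1} (hu : u ∈ D i)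
    (hv : v ∈ D j) (huv : (D i).position u = (D j).position v) {k : ℕ} (hk : k < l) :
    schemeNorm τ 𝓕 u k = schemeNorm τ 𝓕 v k := by
  have key : ∀ u ∈ D 0, ∀ v ∈ D 1, (D 0).position u = (D 1).position v →
      schemeNorm τ 𝓕 u k = schemeNorm τ 𝓕 v k := by
    intro u hu v hv huv
    by_cases huR : u ∈ R
    · rw [h.rootTailTail.eq_of_mem_root huR hv huv]
    · refine schemeNorm_eq_of_lt_delta ?_
      rw [(h.rho_delta u hu v hv huv huR).2]
      exact_mod_cast hk
  rcases eq_or_ne i j with rfl | hij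
  · rw [Finset.position_inj hu hv huv]
  · rcases (by clear hu hv huv; revert hij; revert i j; decide : i = 0 ∧ j = 1 ∨ i = 1 ∧ j = 0) with
      ⟨rfl, rfl⟩ | ⟨rfl, rfl⟩
    · exact key u hu v hv huv
    · exact (key v hv u hu huv.symm).symm

lemma exists_position_eq (h : IsCapturedPair τ 𝓕 D R l) {u : Omega1} (hu : u ∈ D 0) :
    ∃ v ∈ D 1, (D 0).position u = (D 1).position v :=
  ⟨(D 1).orderEmbOfFin h.card_eq.symm ⟨_, Finset.position_lt_card hu⟩,
    Finset.orderEmbOfFin_mem _ _ _, by rw [Finset.position_orderEmbOfFin]⟩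

/-- Both members of a pair captured at level `l` lie in one element of the `l`-th level, provided
that each of them lies in an element of a lower level. -/
lemma exists_level_superset (h : IsCapturedPair τ 𝓕 D R l) (h𝓕 : IsConstructionScheme τ 𝓕)
    (hne : D 0 ≠ D 1) {k : ℕ} (hk : k ≤ l) (hlev : ∀ i, ∃ E ∈ schemeLevel τ 𝓕 k, D i ⊆ E) :
    ∃ E ∈ schemeLevel τ 𝓕 l, ∀ i, D i ⊆ E := by
  have hR := h.rootTailTail
  have hne0 : (D 0).Nonempty := by
    rw [Finset.nonempty_iff_ne_empty]
    intro h0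
    refine hne ?_
    have := h.card_eq
    rw [h0, Finset.card_empty] at this
    rw [h0, Finset.card_eq_zero.1 this.symm]
  obtain ⟨t, htD, ht⟩ := (D 0).exists_max_image id hne0
  obtain ⟨s, hsD, hts⟩ := h.exists_position_eq htD
  -- A point above `s` would have a position that no point of `D 0` can attain, since `t` has the
  -- largest one there.
  have hs : ∀ z ∈ D 1, z ≤ s := by
    intro z hz
    by_contra! hlt
    have h1 := (D 1).strictMonoOn_position hsD hz hlt
    have h2 : (D 1).position z < (D 0).card := h.card_eq ▸ Finset.position_lt_card hz
    have h3 : (D 0).position ((D 0).orderEmbOfFin rfl ⟨_, h2⟩) ≤ (D 0).position t :=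
      (D 0).strictMonoOn_position.monotoneOn (Finset.orderEmbOfFin_mem _ _ _) htD
        (ht _ (Finset.orderEmbOfFin_mem _ _ _))
    rw [Finset.position_orderEmbOfFin] at h3
    simp only at h3
    omega
  -- If the maximum of `D 0` were in the root, then `D 0 ⊆ R ⊆ D 1`, and equal sizes would make the
  -- two sets equal.
  have htR : t ∉ R := by
    intro htR
    refine hne (Finset.eq_of_subset_of_card_le (fun z hz => ?_) h.card_eq.ge)
    refine hR.root_subset 1 ?_
    by_contra hzR
    exact (ht z hz).not_gt (hR.root_before 0 t htR z (Finset.mem_sdiff.2 ⟨hz, hzR⟩))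
  obtain ⟨E, hE, htE, hsE⟩ := h𝓕.exists_level_rho t s
  rw [(h.rho_delta t htD s hsD hts htR).1] at hE
  refine ⟨E, hE, Fin.forall_fin_two.2 ⟨?_, ?_⟩⟩
  · obtain ⟨E₀, hE₀, hsub⟩ := hlev 0
    exact h𝓕.subset_level_of_subset_level hk hE₀ hsub hE htD ht htE
  · obtain ⟨E₀, hE₀, hsub⟩ := hlev 1
    exact h𝓕.subset_level_of_subset_level hk hE₀ hsub hE hsD hs hsE

/-- Subsets occupying the same positions in a captured pair are captured. -/
lemma isCapturedAt_of_subset (h : IsCapturedPair τ 𝓕 D R l) {x : Fin 2 → Finset Omega1}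
    (hx : ∀ i, (x i).Nonempty) (hsub : ∀ i, x i ⊆ D i)
    (himg : (x 0).image (D 0).position = (x 1).image (D 1).position) :
    IsCapturedAt τ 𝓕 x l := by
  have hR := h.rootTailTail
  have himg' : ∀ i, (x i).image (D i).position = (x 0).image (D 0).position :=
    Fin.forall_fin_two.2 ⟨rfl, himg.symm⟩
  have hcard : ∀ i, (x i).card = ((x 0).image (D 0).position).card := by
    intro i
    rw [← himg' i, Finset.card_image_of_injOn]
    exact (D i).strictMonoOn_position.injOn.mono (hsub i)
  have hroot : ∀ i, ∀ z ∈ x i, (z ∈ x 0 ∩ x 1 ↔ z ∈ R) := by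
    intro i z hz
    constructor
    · intro hz'
      rw [← hR.inter_eq 0 1 (by decide)]
      exact Finset.inter_subset_inter (hsub 0) (hsub 1) hz'
    -- The position of `z` is also occupied in the other subset; root positions agree, so the point
    -- there is `z` itself.
    · intro hzR
      have key : ∀ j, z ∈ x j := by
        intro j
        have hmem : (D i).position z ∈ (x j).image (D j).position := by
          rw [himg' j, ← himg' i]
          exact Finset.mem_image_of_mem _ hz
        obtain ⟨w, hw, hwz⟩ := Finset.mem_image.1 hmem
        have : w = z := by
          refine Finset.position_inj (hsub j hw) (hR.root_subset j hzR) ?_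
          rw [hwz, (hR.root_before i).position_eq (hR.root_subset i) hzR,
            (hR.root_before j).position_eq (hR.root_subset j) hzR]
        exact this ▸ hw
      exact Finset.mem_inter.2 ⟨key 0, key 1⟩
  have htail : ∀ i, ∀ z ∈ x i \ (x 0 ∩ x 1), z ∈ D i \ R := by
    intro i z hz
    rw [Finset.mem_sdiff] at hz ⊢
    exact ⟨hsub i hz.1, mt (hroot i z hz.1).2 hz.2⟩
  have hRx : IsRootTailTail x (x 0 ∩ x 1) := by
    refine ⟨Fin.forall_fin_two.2 ⟨Finset.inter_subset_left, Finset.inter_subset_right⟩, ?_, ?_, ?_⟩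
    · simp only [Fin.forall_fin_two]
      simp [Finset.inter_comm]
    · intro i a ha b hb
      exact hR.root_before i a ((hroot 0 a (Finset.mem_inter.1 ha).1).1 ha) b (htail i b hb)
    · intro i j hij
      exact (hR.tails i j hij).imp
        (fun hb a ha b hb' => hb a (htail i a ha) b (htail j b hb'))
        (fun hb a ha b hb' => hb a (htail j a ha) b (htail i b hb'))
  refine ⟨_, hcard, x 0 ∩ x 1, ?_, hRx, fun i a => ?_, fun i j a hij ha => ?_⟩
  · rw [Nat.one_le_iff_ne_zero, Finset.card_ne_zero]
    exact (hx 0).image _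
  · have hmem := Finset.orderEmbOfFin_mem (x i) (hcard i) a
    rw [h.xi_eq i _ (hsub i hmem)]
    refine if_congr ?_ rfl rfl
    rw [← hroot i _ hmem, ← (hRx.root_before i).position_lt_card_iff (hRx.root_subset i) hmem,
      Finset.position_orderEmbOfFin]
  · obtain ⟨rfl, rfl⟩ : i = 0 ∧ j = 1 := by
      revert hij; revert i j; decide
    -- Both sides enumerate the common set of positions increasingly, so the `a`-th elements of `x
    -- 0` and `x 1` occupy the same position in `D 0` and `D 1`.
    have hpos : ∀ i, (D i).position ((x i).orderEmbOfFin (hcard i) a) =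
        ((x 0).image (D 0).position).orderEmbOfFin rfl a := by
      intro i
      refine congrFun (Finset.orderEmbOfFin_unique rfl
        (f := fun a => (D i).position ((x i).orderEmbOfFin (hcard i) a)) ?_ ?_) a
      · intro a
        have := Finset.mem_image_of_mem (D i).position
          (Finset.orderEmbOfFin_mem (x i) (hcard i) a)
        exact (Finset.ext_iff.1 (himg' i) _).1 this
      · intro a b hab
        exact (D i).strictMonoOn_position (hsub i (Finset.orderEmbOfFin_mem _ _ _))
          (hsub i (Finset.orderEmbOfFin_mem _ _ _)) (((x i).orderEmbOfFin _).lt_iff_lt.2 hab)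
    have hmem := Finset.orderEmbOfFin_mem (x 0) (hcard 0) a
    refine h.rho_delta _ (hsub 0 hmem) _ (hsub 1 (Finset.orderEmbOfFin_mem _ _ _)) ?_ ?_
    · rw [hpos, hpos]
    · rw [← hroot 0 _ hmem, ← (hRx.root_before 0).position_lt_card_iff (hRx.root_subset 0) hmem,
        Finset.position_orderEmbOfFin]
      exact ha.not_gt

end IsCapturedPair

end Captured

/-! ### The separating forcing -/

/-- Finite approximations to a separation of `(A_u)` and `(B_u)`: a pair `(u, k)` in a condition
promises that `A_u \ k` is covered by the separating set and `B_u \ k` is disjoint from it. -/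
def SeparatingForcing (A B : Omega1 → Set ℕ) : Type :=
  {p : Finset (Omega1 × ℕ) //
    ∀ a ∈ p, ∀ b ∈ p, ∀ n, a.2 ≤ n → b.2 ≤ n → n ∈ A a.1 → n ∉ B b.1}

namespace SeparatingForcing

variable {A B : Omega1 → Set ℕ}

instance : Preorder (SeparatingForcing A B) where
  le q p := p.1 ⊆ q.1
  le_refl _ := subset_rfl
  le_trans _ _ _ h₁ h₂ := Finset.Subset.trans h₂ h₁

instance : Nonempty (SeparatingForcing A B) := ⟨⟨∅, by simp⟩⟩

/-- The conditions that make a promise about `u`. -/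
def deciding (A B : Omega1 → Set ℕ) (u : Omega1) : Set (SeparatingForcing A B) :=
  {p | ∃ k, (u, k) ∈ p.1}

/-- A promise about `u` starting beyond the finitely many overlaps with sets already mentioned
contradicts nothing. -/
lemma isDense_deciding (hAB : ∀ u v, (A u ∩ B v).Finite) (u : Omega1) :
    Forcing.IsDense (deciding A B u) := by
  intro p
  obtain ⟨N, hN⟩ : ∃ N, ∀ b ∈ insert u (p.1.image Prod.fst),
      ∀ n ∈ A u ∩ B b ∪ A b ∩ B u, n < N := by
    have hfin : (⋃ b ∈ insert u (p.1.image Prod.fst), (A u ∩ B b ∪ A b ∩ B u)).Finite :=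
      Set.Finite.biUnion (Finset.finite_toSet _) fun b _ => (hAB u b).union (hAB b u)
    obtain ⟨N, hN⟩ := hfin.bddAbove
    exact ⟨N + 1, fun b hb n hn => Nat.lt_succ_of_le (hN (Set.mem_biUnion hb hn))⟩
  have hmem : ∀ b ∈ p.1, b.1 ∈ insert u (p.1.image Prod.fst) := fun b hb =>
    Finset.mem_insert_of_mem (Finset.mem_image_of_mem _ hb)
  refine ⟨⟨insert (u, N) p.1, ?_⟩, Finset.subset_insert _ _, N, Finset.mem_insert_self _ _⟩
  intro a ha b hb n han hbn hnA hnB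
  rw [Finset.mem_insert] at ha hb
  rcases ha with rfl | ha <;> rcases hb with rfl | hb
  · exact (hN u (Finset.mem_insert_self _ _) n (Or.inl ⟨hnA, hnB⟩)).not_ge han
  · exact (hN b.1 (hmem b hb) n (Or.inl ⟨hnA, hnB⟩)).not_ge han
  · exact (hN a.1 (hmem a ha) n (Or.inr ⟨hnA, hnB⟩)).not_ge hbn
  · exact p.2 a ha b hb n han hbn hnA hnB

/-- The separating set is the union of all promised parts of the `A_u`. It avoids the promised parts
of the `B_v` because any two conditions in `G` have a common extension. -/
lemma separates_of_pfilter (G : Order.PFilter (SeparatingForcing A B))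
    (hG : ∀ u, ∃ p ∈ deciding A B u, p ∈ G) :
    ∃ C, Separates C (Set.range A) (Set.range B) := by
  refine ⟨{n | ∃ p ∈ G, ∃ a ∈ p.1, a.2 ≤ n ∧ n ∈ A a.1}, ?_, ?_⟩
  · rintro _ ⟨u, rfl⟩
    obtain ⟨p, ⟨k, hk⟩, hp⟩ := hG u
    refine (Set.finite_Iio k).subset fun n ⟨hn, hnC⟩ => ?_
    by_contra hlt
    exact hnC ⟨p, hp, (u, k), hk, not_lt.1 hlt, hn⟩
  · rintro _ ⟨v, rfl⟩
    obtain ⟨q, ⟨k, hk⟩, hq⟩ := hG v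
    refine (Set.finite_Iio k).subset ?_
    rintro n ⟨⟨p, hp, a, ha, han, hnA⟩, hnB⟩
    by_contra hlt
    obtain ⟨r, -, hrp, hrq⟩ := G.directed p hp q hq
    exact r.2 a (hrp ha) (v, k) (hrq hk) n han (not_lt.1 hlt) hnA hnB

end SeparatingForcing

/-! ### From capturing pairs to the ccc, preservation of `𝓕` and sufficiently generic filters. -/

namespace Forcing

/-- A criterion for being ccc and preserving `𝓕`: among uncountably many conditions paired with
finite sets there are two compatible ones whose finite sets are captured. -/
def CapturesPairs (P : Type*) [Preorder P] (τ : SchemeType) (𝓕 : Set (Finset Omega1)) : Prop :=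
  ∀ S : Set (P × FinOmega1), ¬ S.Countable → ∀ N : ℕ, ∃ l, N ≤ l ∧ ∃ c : Fin 2 → P × FinOmega1,
    Function.Injective c ∧ (∀ i, c i ∈ S) ∧ (∃ r, ∀ i, r ≤ (c i).1) ∧
      IsCapturedAt τ 𝓕 (fun i => (c i).2.1) l

section

variable {P : Type*} [Preorder P] {τ : SchemeType} {𝓕 : Set (Finset Omega1)}

lemma CapturesPairs.isCCC (h : CapturesPairs P τ 𝓕) : IsCCC P := by
  intro A hA
  by_contra hA'
  -- The finite sets play no role for the ccc, so every condition is paired with one fixed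
  -- singleton.
  have hinj : Function.Injective fun p : P =>
      ((p, ⟨{Classical.arbitrary Omega1}, by simp⟩) : P × FinOmega1) := fun p q hpq => by
    simpa using hpq
  obtain ⟨l, -, c, hc, hcS, ⟨r, hr⟩, -⟩ := h _
    (fun hcount => hA' (Set.countable_of_injective_of_countable_image hinj.injOn hcount)) 0
  obtain ⟨p, hp, hpc⟩ := hcS 0
  obtain ⟨q, hq, hqc⟩ := hcS 1
  have hpq : p ≠ q := by
    rintro rfl
    exact absurd (hc (hpc.symm.trans hqc)) (by decide)
  have h0 := hr 0
  have h1 := hr 1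
  rw [← hpc] at h0
  rw [← hqc] at h1
  exact (hA hp hq hpq r).elim (fun h => h h0) fun h => h h1

lemma mem_mono {A : Type*} {a : A} {X : SubsetName P A} {p q : P} (hqp : q ≤ p) (h : mem a X p) :
    mem a X q := fun r hr => h r (hr.trans hqp)

/-- If a condition forces `X` to be uncountable, then uncountably many elements are forced into
`X` by stronger conditions. -/
lemma not_countable_of_forces {A : Type*} {X : SubsetName P A} {p : P} (h : not (countable X) p) :
    ¬ {a | ∃ r ≤ p, mem a X r}.Countable := by
  intro hc
  obtain ⟨e, he⟩ := Set.countable_iff_exists_injOn.1 hc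
  -- The name attaches every condition to each pair `(e a, a)`, so it denotes the inverse of the
  -- ground model injection `e`.
  refine h p le_rfl fun q hq => ⟨q, le_rfl,
    {z | z.1.2 ∈ {a | ∃ r ≤ p, mem a X r} ∧ z.1.1 = e z.1.2}, ?_, ?_⟩
  · rintro k a b r - ⟨ha, hb⟩
    obtain ⟨_, _, _, ⟨haX, hka⟩, _⟩ := ha r le_rfl
    obtain ⟨_, _, _, ⟨hbX, hkb⟩, _⟩ := hb r le_rfl
    exact he haX hbX (hka.symm.trans hkb)
  · intro a r hr ha r' hr'
    refine ⟨r', le_rfl, e a, fun r'' hr'' => ⟨r'', le_rfl, r'', ⟨⟨r, hr.trans hq, ha⟩, rfl⟩, le_rfl⟩⟩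

/-- Pair each possible element of the name with a condition forcing it in. A common extension of two
such conditions forces both members of the captured pair into the name. -/
lemma CapturesPairs.preserves (h : CapturesPairs P τ 𝓕) : Preserves P τ 𝓕 2 := by
  intro p X q hq hX N q' hq'
  have hX' : not (countable X) q' := fun r hr => hX r (hr.trans hq')
  have hunc := not_countable_of_forces hX'
  set Y := {a | ∃ r ≤ q', mem a X r}
  have hY : ∀ a : Y, ∃ r ≤ q', mem a.1 X r := fun a => a.2
  choose f hf hfm using hY
  have hS : ¬ (Set.range fun a : Y => (f a, a.1)).Countable := by
    intro hc
    refine hunc (Set.Countable.mono ?_ (hc.image Prod.snd))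
    intro a ha
    exact ⟨_, ⟨⟨a, ha⟩, rfl⟩, rfl⟩
  obtain ⟨l, hl, c, hc, hcS, ⟨r, hr⟩, hcap⟩ := h _ hS N
  choose a ha using hcS
  have ha1 : ∀ i, f (a i) = (c i).1 := fun i => congrArg Prod.fst (ha i)
  have ha2 : ∀ i, (a i).1 = (c i).2 := fun i => congrArg Prod.snd (ha i)
  refine ⟨r, ((hr 0).trans (ha1 0).ge).trans (hf _), l, hl, fun r' hr' => ⟨r', le_rfl,
    fun i => (c i).2, ?_, hcap, fun i => ?_⟩⟩
  · intro i j hij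
    refine hc ?_
    have : a i = a j := Subtype.ext ((ha2 i).trans (hij.trans (ha2 j).symm))
    rw [← ha i, ← ha j, this]
  · have := hfm (a i)
    rw [ha1, ha2] at this
    exact mem_mono (hr'.trans (hr i)) this

end

/-- Martin's axiom for `ℵ₁` dense sets and the ccc forcing notions preserving `𝓕`. -/
lemma exists_pfilter {τ : SchemeType} {𝓕 : Set (Finset Omega1)} (hcap : IsCapturing τ 𝓕 2)
    (hmartin : (Cardinal.aleph 1 : WithTop Cardinal.{0}) < schemeMartinNumber τ 𝓕 2)
    {P : Type} [Preorder P] [hP : Nonempty P] (hccc : IsCCC P) (hpres : Preserves P τ 𝓕 2)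
    (D : Omega1 → Set P) (hD : ∀ u, IsDense (D u)) :
    ∃ G : Order.PFilter P, ∀ u, ∃ p ∈ D u, p ∈ G := by
  by_contra hG
  refine hmartin.not_ge ?_
  rw [schemeMartinNumber, if_pos hcap]
  have hP𝓕 : sInf {x | ∃ (P : Type) (_ : Preorder P), Nonempty P ∧ IsCCC P ∧
      Preserves P τ 𝓕 2 ∧ x = martinNumber P} ≤ martinNumber P :=
    csInf_le' ⟨P, inferInstance, hP, hccc, hpres, rfl⟩
  have hPD : martinNumber P ≤ (Cardinal.mk (Set.range D) : WithTop Cardinal.{0}) := by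
    refine csInf_le' ⟨Set.range D, Set.forall_mem_range.2 hD, ?_, rfl⟩
    rintro ⟨G, hG'⟩
    exact hG ⟨G, fun u => hG' _ ⟨u, rfl⟩⟩
  refine hP𝓕.trans (hPD.trans ?_)
  rw [WithTop.coe_le_coe]
  refine Cardinal.mk_range_le.trans ?_
  simp

end Forcing

/-! ### The forcing separating differences of the left sides from the right sides -/

section Separation

variable {τ : SchemeType} {𝓕 : Set (Finset Omega1)} {s : Omega1 → Omega1}

/-- The forcing that separates `L_{s(u)} \ L_u` from `R_u`. -/
abbrev GapForcing (τ : SchemeType) (𝓕 : Set (Finset Omega1)) (s : Omega1 → Omega1) : Type :=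
  SeparatingForcing (fun u => schemeGapLeft τ 𝓕 (s u) \ schemeGapLeft τ 𝓕 u) (schemeGapRight τ 𝓕)

/-- The ordinals relevant to a condition together with a finite set. -/
def GapForcing.support (c : GapForcing τ 𝓕 s × FinOmega1) : Finset Omega1 :=
  c.1.1.image (fun a => a.1) ∪ c.1.1.image (fun a => s a.1) ∪ c.2.1

/-- The isomorphism type of a condition together with a finite set. -/
def GapForcing.pattern (c : GapForcing τ 𝓕 s × FinOmega1) :
    Finset (ℕ × ℕ) × Finset ℕ × Finset (ℕ × ℕ) :=
  (c.1.1.image fun a => ((support c).position a.1, a.2), c.2.1.image (support c).position,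
    c.1.1.image fun a => ((support c).position a.1, (support c).position (s a.1)))

namespace GapForcing

lemma fst_mem_support {c : GapForcing τ 𝓕 s × FinOmega1} {a : Omega1 × ℕ} (ha : a ∈ c.1.1) :
    a.1 ∈ support c :=
  Finset.mem_union_left _ (Finset.mem_union_left _ (Finset.mem_image_of_mem _ ha))

lemma map_fst_mem_support {c : GapForcing τ 𝓕 s × FinOmega1} {a : Omega1 × ℕ} (ha : a ∈ c.1.1) :
    s a.1 ∈ support c :=
  Finset.mem_union_left _ (Finset.mem_union_right _ (Finset.mem_image_of_mem (fun a => s a.1) ha))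

lemma snd_subset_support (c : GapForcing τ 𝓕 s × FinOmega1) : c.2.1 ⊆ support c :=
  Finset.subset_union_right

/-- Consequently uncountably many conditions of one type have uncountably many supports, to which
capturing applies. -/
lemma eq_of_support_eq_of_pattern_eq {c d : GapForcing τ 𝓕 s × FinOmega1}
    (hs : support c = support d) (hp : pattern c = pattern d) : c = d := by
  have hinj : Set.InjOn (support d).position (support d) := (support d).strictMonoOn_position.injOn
  simp only [pattern, Prod.mk.injEq] at hp
  rw [hs] at hp
  have hinj' : Set.InjOn (fun a : Omega1 × ℕ => ((support d).position a.1, a.2))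
      {a | a.1 ∈ support d} := by
    intro a ha b hb hab
    simp only [Prod.mk.injEq] at hab
    exact Prod.ext (hinj ha hb hab.1) hab.2
  refine Prod.ext (Subtype.ext ?_) (Subtype.ext ?_)
  · have := hp.1
    rw [← Finset.coe_inj, Finset.coe_image, Finset.coe_image, hinj'.image_eq_image_iff] at this
    · exact Finset.coe_injective this
    · exact fun a ha => hs ▸ fst_mem_support ha
    · exact fun a ha => fst_mem_support ha
  · have := hp.2.1
    rw [← Finset.coe_inj, Finset.coe_image, Finset.coe_image, hinj.image_eq_image_iff] at this
    · exact Finset.coe_injective this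
    · exact fun a ha => hs ▸ snd_subset_support c ha
    · exact fun a ha => snd_subset_support d ha

/-- Two conditions of the same isomorphism type whose supports are captured are compatible. -/
lemma exists_le_of_isCapturedPair (h : IsConstructionScheme τ 𝓕) (htwo : ∀ k, τ.n (k + 1) = 2)
    {c : Fin 2 → GapForcing τ 𝓕 s × FinOmega1} {R : Finset Omega1} {l : ℕ}
    (hc : IsCapturedPair τ 𝓕 (fun i => support (c i)) R l)
    (hp : ∀ i j, pattern (c i) = pattern (c j))
    (hE : ∃ E ∈ schemeLevel τ 𝓕 l, ∀ i, support (c i) ⊆ E) : ∃ r, ∀ i, r ≤ (c i).1 := by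
  have hR := hc.rootTailTail
  -- A root point `a.1` has the same position in both supports, so equality of the third components
  -- of the patterns makes it occur in both conditions. Then `s a.1` is in both supports.
  have hroot : ∀ i, ∀ a ∈ (c i).1.1, a.1 ∈ R → s a.1 ∈ R := by
    intro i a ha haR
    have key : ∀ j, s a.1 ∈ support (c j) := by
      intro j
      have hmem : ((support (c i)).position a.1, (support (c i)).position (s a.1)) ∈
          (pattern (c j)).2.2 := by
        rw [← hp i j]
        exact Finset.mem_image_of_mem (fun a : Omega1 × ℕ =>
          ((support (c i)).position a.1, (support (c i)).position (s a.1))) ha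
      obtain ⟨b, hb, hba⟩ := Finset.mem_image.1 hmem
      have hab := hR.eq_of_mem_root (i := i) (j := j) haR (fst_mem_support hb)
        (congrArg Prod.fst hba).symm
      rw [hab]
      exact map_fst_mem_support hb
    rw [← hR.inter_eq 0 1 (by decide)]
    exact Finset.mem_inter.2 ⟨key 0, key 1⟩
  have hcompat : ∀ i j, ∀ a ∈ (c i).1.1, ∀ b ∈ (c j).1.1, ∀ n, a.2 ≤ n → b.2 ≤ n →
      n ∈ schemeGapLeft τ 𝓕 (s a.1) \ schemeGapLeft τ 𝓕 a.1 → n ∉ schemeGapRight τ 𝓕 b.1 := by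
    intro i j a ha b hb n han hbn hnA hnB
    rcases lt_trichotomy (n / 2) l with hlt | heq | hgt
    -- Below level `l` the promise `b` can be replaced by its counterpart `b'` in the condition of
    -- `a`, since `Δ = l` makes `Ξ` agree at equal positions.
    · have hmem : ((support (c j)).position b.1, b.2) ∈ (pattern (c i)).1 := by
        rw [hp i j]
        exact Finset.mem_image_of_mem (fun a : Omega1 × ℕ =>
          ((support (c j)).position a.1, a.2)) hb
      obtain ⟨b', hb', hbb⟩ := Finset.mem_image.1 hmem
      rw [Prod.mk.injEq] at hbb
      refine (c i).1.2 a ha b' hb' n han (hbb.2 ▸ hbn) hnA ?_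
      rw [mem_schemeGapRight h htwo] at hnB ⊢
      rw [h.xi_eq_of_norm_eq htwo (hc.norm_eq (i := i) (j := j) (fst_mem_support hb')
        (fst_mem_support hb) hbb.1 hlt)]
      exact hnB
    -- At level `l`, membership in `L_{s(a)}` puts `s a.1` off the root, hence also `a.1`. Both then
    -- have the value `i`, so `n` is in `L_a` as well and not in the difference.
    · have h1 := (mem_schemeGapLeft h htwo).1 hnA.1
      have hxs := hc.xi_eq i _ (map_fst_mem_support ha)
      have hxa := hc.xi_eq i _ (fst_mem_support ha)
      rw [heq] at h1
      have hsR : s a.1 ∉ R := by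
        intro hsR
        rw [if_pos hsR] at hxs
        omega
      have haR : a.1 ∉ R := mt (hroot i a ha) hsR
      refine hnA.2 ((mem_schemeGapLeft h htwo).2 ?_)
      rw [heq, hxa, if_neg haR]
      rwa [hxs, if_neg hsR] at h1
    · obtain ⟨E, hE, hsub⟩ := hE
      have h1 := le_rho_of_mem_left_right h htwo hnA.1 hnB
      have h2 := schemeRho_le hE (hsub i (map_fst_mem_support ha)) (hsub j (fst_mem_support hb))
      omega
  refine ⟨⟨Finset.univ.biUnion fun i => (c i).1.1, ?_⟩,
    fun i => Finset.subset_biUnion_of_mem (fun i => (c i).1.1) (Finset.mem_univ i)⟩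
  intro a ha b hb
  obtain ⟨i, -, ha⟩ := Finset.mem_biUnion.1 ha
  obtain ⟨j, -, hb⟩ := Finset.mem_biUnion.1 hb
  exact hcompat i j a ha b hb

lemma capturesPairs (h : IsConstructionScheme τ 𝓕) (htwo : ∀ k, τ.n (k + 1) = 2)
    (hcap : IsCapturing τ 𝓕 2) (s : Omega1 → Omega1) :
    Forcing.CapturesPairs (GapForcing τ 𝓕 s) τ 𝓕 := by
  intro S hS N
  have hlev : ∀ c : GapForcing τ 𝓕 s × FinOmega1, ∃ k, ∃ E ∈ schemeLevel τ 𝓕 k, support c ⊆ E := by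
    intro c
    obtain ⟨k, -, E, hE, hsub⟩ := h.exists_level_superset (support c) 0
    exact ⟨k, E, hE, hsub⟩
  choose lev hlev using hlev
  obtain ⟨χ, hχ⟩ : ∃ χ, ¬ (S ∩ (fun c => (pattern c, lev c)) ⁻¹' {χ}).Countable := by
    by_contra! hc
    refine hS ?_
    rw [← Set.inter_univ S, ← Set.preimage_univ (f := fun c => (pattern c, lev c)),
      ← Set.iUnion_of_singleton, Set.preimage_iUnion, Set.inter_iUnion]
    exact Set.countable_iUnion hc
  set S' := S ∩ (fun c => (pattern c, lev c)) ⁻¹' {χ}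
  have hpat : ∀ c ∈ S', pattern c = χ.1 := fun c hc => congrArg Prod.fst hc.2
  have hlevel : ∀ c ∈ S', lev c = χ.2 := fun c hc => congrArg Prod.snd hc.2
  let supp : GapForcing τ 𝓕 s × FinOmega1 → FinOmega1 := fun c =>
    ⟨support c, c.2.2.mono (snd_subset_support c)⟩
  have hinj : Set.InjOn supp S' := fun c hc d hd hcd =>
    eq_of_support_eq_of_pattern_eq (congrArg Subtype.val hcd) ((hpat c hc).trans (hpat d hd).symm)
  -- Demanding `l ≥ χ.2` puts each support inside a member of a level at most `l`, as needed for
  -- enclosing both in one member of `𝓕_l`.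
  obtain ⟨l, hl, D, hD, hDcap, hDS⟩ := hcap (supp '' S')
    (fun hc => hχ (Set.countable_of_injective_of_countable_image hinj hc)) (max N χ.2)
  choose c hc hcD using hDS
  obtain rfl : D = fun i => supp (c i) := funext fun i => (hcD i).symm
  obtain ⟨R, hR⟩ := hDcap.exists_isCapturedPair
  have hp : ∀ i j, pattern (c i) = pattern (c j) := fun i j =>
    (hpat _ (hc i)).trans (hpat _ (hc j)).symm
  refine ⟨l, (le_max_left _ _).trans hl, c, fun i j hij => hD (congrArg supp hij),
    fun i => (hc i).1, ?_, ?_⟩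
  · refine exists_le_of_isCapturedPair h htwo hR hp ?_
    refine hR.exists_level_superset h ?_ ((le_max_right _ _).trans hl) fun i => ?_
    · intro heq
      exact absurd (hD (Subtype.ext heq)) (by decide)
    · rw [← hlevel _ (hc i)]
      exact hlev (c i)
  · exact hR.isCapturedAt_of_subset (fun i => (c i).2.2) (fun i => snd_subset_support (c i))
      (congrArg (fun x => x.2.1) (hp 0 1))

end GapForcing

/-- Under the Martin-type hypothesis, the differences `L_{s(u)} \ L_u` can be separated from all
right sides of the gap, for any function `s`. -/
lemma exists_separates_diff (h : IsConstructionScheme τ 𝓕) (htwo : ∀ k, τ.n (k + 1) = 2)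
    (hcap : IsCapturing τ 𝓕 2)
    (hmartin : (Cardinal.aleph 1 : WithTop Cardinal.{0}) < schemeMartinNumber τ 𝓕 2)
    (s : Omega1 → Omega1) :
    ∃ C, Separates C (Set.range fun u => schemeGapLeft τ 𝓕 (s u) \ schemeGapLeft τ 𝓕 u)
      (Set.range (schemeGapRight τ 𝓕)) := by
  have hP := GapForcing.capturesPairs h htwo hcap s
  obtain ⟨G, hG⟩ := Forcing.exists_pfilter hcap hmartin hP.isCCC hP.preserves
    (SeparatingForcing.deciding _ _) (SeparatingForcing.isDense_deciding fun u v =>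
      (finite_left_inter_right h htwo (s u) v).subset
        (Set.inter_subset_inter_left _ Set.sdiff_subset))
  exact SeparatingForcing.separates_of_pfilter G hG

end Separation

end

/-! ### Excluding levelwise-inseparable subgaps. -/

theorem mainTheorem2 (τ : SchemeType) (hgood : τ.Good) (htwo : ∀ k, τ.n (k + 1) = 2)
    (𝓕 : Set (Finset Omega1)) (h𝓕 : IsConstructionScheme τ 𝓕) (hcap : IsCapturing τ 𝓕 2)
    (hmartin : (Cardinal.aleph 1 : WithTop Cardinal.{0}) < schemeMartinNumber τ 𝓕 2) :
    IsOmega1Gap (schemeGapLeft τ 𝓕) (schemeGapRight τ 𝓕) ∧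
      HausdorffCondition (schemeGapLeft τ 𝓕) (schemeGapRight τ 𝓕) ∧
      ¬ IsWeaklyLevelwiseInseparable (schemeGapLeft τ 𝓕) (schemeGapRight τ 𝓕) := by
  classical
  refine ⟨isOmega1Gap_schemeGap h𝓕 htwo, hausdorffCondition_schemeGap h𝓕 htwo, ?_⟩
  rintro ⟨L', R', hL, hR, hgap, -, hsep⟩
  choose f hf using fun α => hL ⟨α, rfl⟩
  -- If the left side truly grows at `α`, its value there cannot recur later: `L'_β` almost contains
  -- `L'_{α+1}`. So the index `f α` determines `α` among such stages and `s` below is well defined;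
  -- its default value is never used.
  have hinj : ∀ α β, α < β → ¬ AlmostSubset (L' (Order.succ α)) (L' α) → f α ≠ f β := by
    intro α β hlt hα heq
    have := hgap.left_mono _ _ (Order.succ_le_of_lt hlt)
    rw [← hf β, ← heq, hf α] at this
    exact hα this
  let s : Omega1 → Omega1 := fun u =>
    if hu : ∃ α, f α = u ∧ ¬ AlmostSubset (L' (Order.succ α)) (L' α)
    then f (Order.succ hu.choose) else u
  have hs : ∀ α, ¬ AlmostSubset (L' (Order.succ α)) (L' α) → s (f α) = f (Order.succ α) := by
    intro α hα
    have hu : ∃ β, f β = f α ∧ ¬ AlmostSubset (L' (Order.succ β)) (L' β) := ⟨α, rfl, hα⟩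
    have heq : hu.choose = α := by
      obtain ⟨h1, h2⟩ := hu.choose_spec
      rcases lt_trichotomy hu.choose α with hlt | heq | hlt
      · exact absurd h1 (hinj _ _ hlt h2)
      · exact heq
      · exact absurd h1.symm (hinj _ _ hlt hα)
    simp only [s]
    rw [dif_pos hu, heq]
  obtain ⟨C, hCL, hCR⟩ := exists_separates_diff h𝓕 htwo hcap hmartin s
  refine hsep ⟨C, ?_, ?_⟩
  · rintro _ ⟨α, rfl⟩
    -- Where the left side does not grow, the difference is finite and any `C` almost covers it.
    by_cases hα : AlmostSubset (L' (Order.succ α)) (L' α)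
    · exact Set.Finite.subset hα Set.sdiff_subset
    · have := hCL _ ⟨f α, rfl⟩
      beta_reduce at this ⊢
      rwa [hs α hα, hf, hf] at this
  · rintro _ ⟨α, rfl⟩
    obtain ⟨v, hv⟩ := hR ⟨Order.succ α, rfl⟩
    refine (hCR _ ⟨v, rfl⟩).subset (Set.inter_subset_inter_right _ ?_)
    rw [hv]
    exact Set.sdiff_subset
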